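/- Let $d,n\ge 1$ and let $\mathcal S\subset\{0,1\}^d$ be a nonempty set such that for every $i\in\{1,\dots,d\}$ some $v\in\mathcal S$ has $v_i=1$. In the semi-bandit game on $\mathcal S$, in each round $t=1,\dots,n$ the forecaster draws $V_t\in\mathcal S$ from a distribution $p_t$ on $\mathcal S$ fixed before the round, while the adversary simultaneously selects a loss vector $\ell_t\in[0,\infty)^d$, possibly at random and depending on the previous rounds: conditionally on the past and on $\ell_t$, the action $V_t$ has law $p_t$. The forecaster then observes the coordinates $\ell_{i,t}$ for which $V_{i,t}=1$. The regret is $$\overline R_n=\mathbb E\sum_{t=1}^n \ell_t^TV_t-\min_{v\in\mathcal S}\mathbb E\sum_{t=1}^n\ell_t^Tv .$$ Assume the $L_2$ condition: $\ell_t^Tv\le 1$ for all $t$ and all $v\in\mathcal S$. For $q>1$ and $\eta>0$ let $F(u)=-\frac{q}{(q-1)\eta}\sum_{i=1}^d u_i^{(q-1)/q}$ on $[0,\infty)^d$, and $D_F(u,v)=F(u)-F(v)-(u-v)^T\nabla F(v)$ for $u\in[0,\infty)^d$, $v\in(0,\infty)^d$. The forecaster {\sc linpoly}, with importance-weighted estimates,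 starts from $w_1=\operatorname{argmin}_{w\in\mathrm{Conv}(\mathcal S)}D_F\big(w,(1,\dots,1)^T\big)\in(0,\infty)^d$. In each round $t=1,\dots,n$ it draws $V_t$ from a distribution $p_t$ on $\mathcal S$ with mean $w_t$, sets $\tilde\ell_{i,t}=\ell_{i,t}\frac{V_{i,t}}{w_{i,t}}$, takes $w'_{t+1}\in(0,\infty)^d$ with $\nabla F(w'_{t+1})=\nabla F(w_t)-\tilde\ell_t$, and takes $w_{t+1}\in\operatorname{argmin}_{w\in\mathrm{Conv}(\mathcal S)\cap(0,\infty)^d}D_F(w,w'_{t+1})$. Then for every $q>1$, {\sc linpoly} with $$\eta=\sqrt{\frac{2d^{1/q}}{q(q-1)n}}$$ satisfies $$\overline R_n\le\sqrt{\frac{2qnd}{q-1}\,d^{1-\frac1q}} .$$ In particular, if $d\ge 2$ and $q=1+(\log d)^{-1}$, then $$\overline R_n\le\sqrt{2e\,n\,d\,\log(ed)} .$$ -/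

import Mathlib

open MeasureTheory

/-- The set `[0, ∞)^d`, the domain `𝒟` of the potential of linpoly. -/
def nonnegOrthant (d : ℕ) : Set (EuclideanSpace ℝ (Fin d)) :=
  {u | ∀ i, 0 ≤ u i}

/-- The vector `(1, …, 1)`. -/
noncomputable def onesVec (d : ℕ) : EuclideanSpace ℝ (Fin d) :=
  WithLp.toLp 2 (fun _ => (1 : ℝ))

/-- The Bregman divergence `D_F(u, v) = F(u) - F(v) - (u - v)ᵀ ∇F(v)`, meaningful for `v` in the
interior of the domain of `F`. -/
noncomputable def bregmanDiv {d : ℕ} (F : EuclideanSpace ℝ (Fin d) → ℝ)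
    (u v : EuclideanSpace ℝ (Fin d)) : ℝ :=
  F u - F v - inner ℝ (u - v) (gradient F v)

/-- One run of the CLEB forecaster (combinatorial learning with Bregman projections) with potential
`F` on the domain `D` and action set `S`, over `n` rounds numbered `0, …, n - 1`. Here `w t` is the
weight vector, `p t` the distribution on `S` used for drawing the action, and `lossEst t` the
estimate of the loss vector in round `t`. -/
structure IsCLEBRun {d : ℕ} (D : Set (EuclideanSpace ℝ (Fin d)))
    (F : EuclideanSpace ℝ (Fin d) → ℝ) (S : Finset (EuclideanSpace ℝ (Fin d))) (n : ℕ)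
    (w : ℕ → EuclideanSpace ℝ (Fin d)) (p : ℕ → EuclideanSpace ℝ (Fin d) → ℝ)
    (lossEst : ℕ → EuclideanSpace ℝ (Fin d)) : Prop where
  /-- The initial weight vector is an admissible parameter. -/
  init_mem : w 0 ∈ convexHull ℝ (S : Set (EuclideanSpace ℝ (Fin d))) ∩ interior D
  /-- `p t` is a probability distribution on `S` … -/
  p_nonneg : ∀ t < n, ∀ v ∈ S, 0 ≤ p t v
  p_sum : ∀ t < n, ∑ v ∈ S, p t v = 1
  /-- … with mean `w t`. -/
  p_mean : ∀ t < n, ∑ v ∈ S, p t v • v = w t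
  /-- Gradient step followed by a Bregman projection onto the convex hull of `S`. -/
  update : ∀ t < n, ∃ w' ∈ interior D,
    gradient F w' = gradient F (w t) - lossEst t ∧
    w (t + 1) ∈ convexHull ℝ (S : Set (EuclideanSpace ℝ (Fin d))) ∩ interior D ∧
    IsMinOn (fun u => bregmanDiv F u w')
      (convexHull ℝ (S : Set (EuclideanSpace ℝ (Fin d))) ∩ interior D) (w (t + 1))

/-- The potential `F(u) = -(q / ((q - 1) η)) ∑ i, u_i ^ ((q - 1) / q)` of linpoly. -/
noncomputable def linpolyPotential {d : ℕ} (q η : ℝ) (u : EuclideanSpace ℝ (Fin d)) : ℝ :=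
  -(q / ((q - 1) * η)) * ∑ i, (u i) ^ ((q - 1) / q)

/-- The importance-weighted loss estimate `ℓ_i V_i / w_i`. As `V_i ∈ {0, 1}`, it depends on `ℓ` only
through the coordinates with `V_i = 1`, which are the ones observed in the semi-bandit game. -/
noncomputable def importanceWeightedEst {d : ℕ} (l v w : EuclideanSpace ℝ (Fin d)) :
    EuclideanSpace ℝ (Fin d) :=
  WithLp.toLp 2 (fun i => l i * (v i / w i))

/-- A run of linpoly with parameters `q`, `η`, in the semi-bandit game: CLEB on `[0, ∞)^d` with the
linpoly potential and the importance-weighted estimates of the losses `l`, where `V t` is the action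
played in round `t`, started at the Bregman projection of `(1, …, 1)` onto the convex hull of
`S`. -/
structure IsLinpolyRun {d : ℕ} (q η : ℝ) (S : Finset (EuclideanSpace ℝ (Fin d))) (n : ℕ)
    (w : ℕ → EuclideanSpace ℝ (Fin d)) (p : ℕ → EuclideanSpace ℝ (Fin d) → ℝ)
    (V l : ℕ → EuclideanSpace ℝ (Fin d)) : Prop where
  cleb : IsCLEBRun (nonnegOrthant d) (linpolyPotential q η) S n w p
    (fun t => importanceWeightedEst (l t) (V t) (w t))
  init_min : IsMinOn (fun u => bregmanDiv (linpolyPotential q η) u (onesVec d))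
    (convexHull ℝ (S : Set (EuclideanSpace ℝ (Fin d)))) (w 0)

/-- The protocol of a combinatorial prediction game with `n` rounds (numbered `0, …, n - 1`) and
action set `S`, played by a randomized forecaster against a possibly randomized adversary, who may
react to everything that happened in the earlier rounds. `ℱ t` is all the information present before
round `t` (past actions, past losses, past internal randomization of both players). In
round `t` the forecaster draws `V t` from the distribution `p t` on `S` while the adversary
simultaneously selects `l t`. The forecaster's `p t` may in particular be a function of his own
past observations only, as in the semi-bandit game. -/
structure IsPredictionGame {d : ℕ} {Ω : Type*} {mΩ : MeasurableSpace Ω} (P : Measure Ω)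
    (ℱ : Filtration ℕ mΩ) (S : Finset (EuclideanSpace ℝ (Fin d))) (n : ℕ)
    (p : ℕ → Ω → EuclideanSpace ℝ (Fin d) → ℝ)
    (V l : ℕ → Ω → EuclideanSpace ℝ (Fin d)) : Prop where
  /-- `p t` is fixed before round `t`. -/
  p_meas : ∀ t < n, ∀ v ∈ S, Measurable[ℱ t] (fun ω => p t ω v)
  V_mem : ∀ t < n, ∀ ω, V t ω ∈ S
  V_meas : ∀ t < n, Measurable[ℱ (t + 1)] (V t)
  l_nonneg : ∀ t < n, ∀ ω i, 0 ≤ l t ω i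
  l_meas : ∀ t < n, Measurable[ℱ (t + 1)] (l t)
  /-- Conditionally on the past and on the simultaneously selected loss vector, `V t` has
  distribution `p t`. -/
  draw : ∀ t < n, ∀ v ∈ S,
    P[({ω | V t ω = v}).indicator (fun _ => (1 : ℝ)) |
        ℱ t ⊔ MeasurableSpace.comap (l t) inferInstance] =ᵐ[P] fun ω => p t ω v

/-- The regret `E ∑ t, ℓ_tᵀ V_t - min_{v ∈ S} E ∑ t, ℓ_tᵀ v`. -/
noncomputable def expectedRegret {d : ℕ} {Ω : Type*} {mΩ : MeasurableSpace Ω} (P : Measure Ω)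
    (S : Finset (EuclideanSpace ℝ (Fin d))) (hS : S.Nonempty) (n : ℕ)
    (V l : ℕ → Ω → EuclideanSpace ℝ (Fin d)) : ℝ :=
  (∫ ω, ∑ t ∈ Finset.range n, inner ℝ (l t ω) (V t ω) ∂P) -
    S.inf' hS (fun v => ∫ ω, ∑ t ∈ Finset.range n, inner ℝ (l t ω) v ∂P)

/-!
The linpoly forecaster is mirror descent for the Bregman divergence of `F`. By the generalized
Pythagorean inequality a projection step does not increase `D_F(v, ·)` for `v ∈ S`, so these
divergences telescope, and a round costs `⟨z, w - v⟩` at most the decrease of `D_F(v, ·)` plus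
`D_F(w, w')`, where `w'` is the result of the gradient step along the estimate `z`. Second-order
Taylor expansion in the dual variables `w_i ^ (-1/q)` gives
`D_F(w, w') ≤ (η q / 2) ∑ i, w_i ^ (1 + 1/q) z_i ^ 2`. The estimate is unbiased, and the expectation
of this last sum is at most `∑ i, ℓ_i ^ 2 w_i ^ (1/q) ≤ ∑ i, (ℓ_i w_i) ^ (1/q)`, which Hölder's
inequality bounds by `d ^ (1 - 1/q)`, as `∑ i, ℓ_i w_i ≤ 1`. The estimates are unbounded, so their
integrability has to be extracted from the same computation, carried out with Lebesgue integrals of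
nonnegative functions.
-/

/-! ### Inequalities for real powers -/

theorem one_sub_mul_le_one_add_rpow_neg {p x : ℝ} (hp : 0 ≤ p) (hx : -1 < x) :
    1 - p * x ≤ (1 + x) ^ (-p) := by
  have hx' : 0 < 1 + x := by linarith
  have hlog : Real.log (1 + x) ≤ x := by linarith [Real.log_le_sub_one_of_pos hx']
  calc 1 - p * x ≤ Real.log (1 + x) * -p + 1 := by nlinarith
    _ ≤ Real.exp (Real.log (1 + x) * -p) := Real.add_one_le_exp _
    _ = (1 + x) ^ (-p) := (Real.rpow_def_of_pos hx' _).symm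

theorem one_add_rpow_neg_le {p x : ℝ} (hp : 0 ≤ p) (hx : 0 ≤ x) :
    (1 + x) ^ (-p) ≤ 1 - p * x + p * (p + 1) / 2 * x ^ 2 := by
  let f : ℝ → ℝ := fun y => 1 - p * y + p * (p + 1) / 2 * y ^ 2 - (1 + y) ^ (-p)
  have hderiv : ∀ y : ℝ, 0 ≤ y →
      HasDerivAt f (p * ((1 + y) ^ (-(p + 1)) - (1 - (p + 1) * y))) y := by
    intro y hy
    have hpow := ((hasDerivAt_id y).const_add 1).rpow_const (p := -p) (Or.inl (by simp; linarith))
    refine (((((hasDerivAt_id y).const_mul p).const_sub 1).add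
      (((hasDerivAt_id y).pow 2).const_mul (p * (p + 1) / 2))).sub hpow).congr_deriv ?_
    rw [show -p - 1 = -(p + 1) by ring]
    simp
    ring
  have hmono : MonotoneOn f (Set.Ici 0) := by
    refine monotoneOn_of_deriv_nonneg (convex_Ici 0)
      (fun y hy => (hderiv y hy).continuousAt.continuousWithinAt)
      (fun y hy => (hderiv y (interior_subset hy)).differentiableAt.differentiableWithinAt)
      fun y hy => ?_
    have hy0 : 0 ≤ y := interior_subset hy
    rw [(hderiv y hy0).deriv]
    have := one_sub_mul_le_one_add_rpow_neg (p := p + 1) (by linarith) (by linarith : -1 < y)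
    exact mul_nonneg hp (by linarith)
  have hle : f 0 ≤ f x := hmono Set.self_mem_Ici hx hx
  simp [f] at hle
  linarith

theorem sum_rpow_one_div_le {ι : Type*} (s : Finset ι) {q : ℝ} (hq : 1 ≤ q) {x : ι → ℝ}
    (hx : ∀ i ∈ s, 0 ≤ x i) :
    ∑ i ∈ s, x i ^ (1 / q) ≤ (s.card : ℝ) ^ (1 - 1 / q) * (∑ i ∈ s, x i) ^ (1 / q) := by
  have hq0 : 0 < q := by linarith
  have hx' : ∀ i ∈ s, 0 ≤ x i ^ (1 / q) := fun i hi => Real.rpow_nonneg (hx i hi) _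
  have hpow : ∀ i ∈ s, (x i ^ (1 / q)) ^ q = x i := fun i hi => by
    rw [← Real.rpow_mul (hx i hi), one_div_mul_cancel hq0.ne', Real.rpow_one]
  have hjensen := Real.rpow_sum_le_const_mul_sum_rpow_of_nonneg s hq hx'
  rw [Finset.sum_congr rfl hpow, ← Real.le_rpow_inv_iff_of_pos (Finset.sum_nonneg hx')
    (mul_nonneg (by positivity) (Finset.sum_nonneg hx)) hq0,
    Real.mul_rpow (by positivity) (Finset.sum_nonneg hx),
    ← Real.rpow_mul (by positivity)] at hjensen
  rwa [← one_div, show (q - 1) * (1 / q) = 1 - 1 / q by field_simp] at hjensen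

theorem sum_sq_mul_rpow_le {ι : Type*} (s : Finset ι) {q : ℝ} (hq : 1 ≤ q) {l w : ι → ℝ}
    (hl : ∀ i ∈ s, l i ∈ Set.Icc 0 1) (hw : ∀ i ∈ s, 0 ≤ w i) (hlw : ∑ i ∈ s, l i * w i ≤ 1) :
    ∑ i ∈ s, l i ^ 2 * w i ^ (1 / q) ≤ (s.card : ℝ) ^ (1 - 1 / q) := by
  have hq' : 1 / q ≤ 2 := by rw [div_le_iff₀ (by linarith)]; linarith
  have hlw0 : ∀ i ∈ s, 0 ≤ l i * w i := fun i hi => mul_nonneg (hl i hi).1 (hw i hi)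
  have hsq : ∀ i ∈ s, l i ^ 2 ≤ l i ^ (1 / q) := fun i hi => by
    rw [← Real.rpow_natCast]
    exact Real.rpow_le_rpow_of_exponent_ge_of_imp (hl i hi).1 (hl i hi).2 (mod_cast hq') (by simp)
  calc ∑ i ∈ s, l i ^ 2 * w i ^ (1 / q)
      ≤ ∑ i ∈ s, (l i * w i) ^ (1 / q) := Finset.sum_le_sum fun i hi => by
        rw [Real.mul_rpow (hl i hi).1 (hw i hi)]
        exact mul_le_mul_of_nonneg_right (hsq i hi) (Real.rpow_nonneg (hw i hi) _)
    _ ≤ (s.card : ℝ) ^ (1 - 1 / q) * (∑ i ∈ s, l i * w i) ^ (1 / q) :=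
        sum_rpow_one_div_le s hq hlw0
    _ ≤ (s.card : ℝ) ^ (1 - 1 / q) := mul_le_of_le_one_right (by positivity)
        (Real.rpow_le_one (Finset.sum_nonneg hlw0) hlw (by positivity))

/-! ### Bregman divergences and the CLEB forecaster -/

section Bregman

variable {d : ℕ} {F : EuclideanSpace ℝ (Fin d) → ℝ}

theorem bregmanDiv_three_point (F : EuclideanSpace ℝ (Fin d) → ℝ)
    (u v w : EuclideanSpace ℝ (Fin d)) :
    inner ℝ (gradient F v - gradient F w) (v - u) =
      bregmanDiv F u v - bregmanDiv F u w + bregmanDiv F v w := by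
  simp only [bregmanDiv, inner_sub_left, inner_sub_right, real_inner_comm (gradient F _)]
  ring

theorem hasGradientAt_bregmanDiv_left {v : EuclideanSpace ℝ (Fin d)} (hF : DifferentiableAt ℝ F v)
    (w : EuclideanSpace ℝ (Fin d)) :
    HasGradientAt (fun u => bregmanDiv F u w) (gradient F v - gradient F w) v := by
  have hlin : HasFDerivAt (fun u => inner ℝ (u - w) (gradient F w))
      (InnerProductSpace.toDual ℝ _ (gradient F w)) v := by
    simp_rw [real_inner_comm (gradient F w), inner_sub_right]
    exact (InnerProductSpace.toDual ℝ _ (gradient F w)).hasFDerivAt.sub_const _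
  rw [hasGradientAt_iff_hasFDerivAt, map_sub]
  exact (hF.hasGradientAt.hasFDerivAt.sub_const _).sub hlin

theorem bregmanDiv_add_bregmanDiv_le_of_isMinOn {C : Set (EuclideanSpace ℝ (Fin d))}
    {u v w : EuclideanSpace ℝ (Fin d)} (hu : openSegment ℝ v u ⊆ C) (hF : DifferentiableAt ℝ F v)
    (hmin : IsMinOn (fun x => bregmanDiv F x w) C v) :
    bregmanDiv F u v + bregmanDiv F v w ≤ bregmanDiv F u w := by
  have hopt := hmin.localize.hasFDerivWithinAt_nonneg
    (hasGradientAt_bregmanDiv_left hF w).hasFDerivAt.hasFDerivWithinAt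
    (sub_mem_posTangentConeAt_of_openSegment_subset hu)
  rw [InnerProductSpace.toDual_apply_apply, ← neg_sub v u, inner_neg_right,
    bregmanDiv_three_point] at hopt
  linarith

theorem bregmanDiv_nonneg {D : Set (EuclideanSpace ℝ (Fin d))} (hF : ConvexOn ℝ D F)
    {u w : EuclideanSpace ℝ (Fin d)} (hu : u ∈ D) (hw : w ∈ D) (hFw : DifferentiableAt ℝ F w) :
    0 ≤ bregmanDiv F u w := by
  let L : ℝ →ᵃ[ℝ] EuclideanSpace ℝ (Fin d) := AffineMap.lineMap w u
  have hconv : ConvexOn ℝ (L ⁻¹' D) (F ∘ L) := hF.comp_affineMap L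
  have hderiv : HasDerivAt (F ∘ L) (inner ℝ (gradient F w) (u - w)) 0 := by
    have hF0 : HasFDerivAt F (InnerProductSpace.toDual ℝ _ (gradient F w)) (L 0) := by
      simpa [L] using hFw.hasGradientAt.hasFDerivAt
    simpa [L] using hF0.comp_hasDerivAt 0 (AffineMap.hasDerivAt_lineMap (a := w) (b := u))
  have hslope := hconv.le_slope_of_hasDerivAt (x := 0) (y := 1) (by simpa [L] using hw)
    (by simpa [L] using hu) zero_lt_one hderiv
  simp only [slope_def_field, Function.comp_apply, L, AffineMap.lineMap_apply_one,
    AffineMap.lineMap_apply_zero, sub_zero, div_one] at hslope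
  rw [bregmanDiv, real_inner_comm]
  linarith

variable {D : Set (EuclideanSpace ℝ (Fin d))} {S : Finset (EuclideanSpace ℝ (Fin d))} {n : ℕ}
  {w : ℕ → EuclideanSpace ℝ (Fin d)} {p : ℕ → EuclideanSpace ℝ (Fin d) → ℝ}
  {z : ℕ → EuclideanSpace ℝ (Fin d)}

theorem IsCLEBRun.mem (hrun : IsCLEBRun D F S n w p z) {t : ℕ} (ht : t ≤ n) :
    w t ∈ convexHull ℝ (S : Set (EuclideanSpace ℝ (Fin d))) ∩ interior D := by
  cases t with
  | zero => exact hrun.init_mem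
  | succ t =>
    obtain ⟨_, _, _, hmem, _⟩ := hrun.update t ht
    exact hmem

theorem openSegment_subset_convexHull_inter_interior {E : Type*} [AddCommGroup E] [Module ℝ E]
    [TopologicalSpace E] [IsTopologicalAddGroup E] [ContinuousConstSMul ℝ E] {s D : Set E}
    (hD : Convex ℝ D) {u v : E} (hv : v ∈ convexHull ℝ s ∩ interior D) (hus : u ∈ s) (hu : u ∈ D) :
    openSegment ℝ v u ⊆ convexHull ℝ s ∩ interior D :=
  Set.subset_inter
    ((convex_convexHull ℝ s).openSegment_subset hv.1 (subset_convexHull ℝ s hus))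
    (hD.openSegment_interior_self_subset_interior hv.2 hu)

theorem IsCLEBRun.sum_inner_sub_le (hrun : IsCLEBRun D F S n w p z) (hF : ConvexOn ℝ D F)
    (hdiff : ∀ x ∈ interior D, DifferentiableAt ℝ F x) {v : EuclideanSpace ℝ (Fin d)} (hvS : v ∈ S)
    (hvD : v ∈ D) {B : ℕ → ℝ}
    (hB : ∀ t < n, ∀ w' ∈ interior D, gradient F w' = gradient F (w t) - z t →
      bregmanDiv F (w t) w' ≤ B t) :
    ∑ t ∈ Finset.range n, inner ℝ (z t) (w t - v) ≤
      bregmanDiv F v (w 0) + ∑ t ∈ Finset.range n, B t := by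
  have hround : ∀ t ∈ Finset.range n, inner ℝ (z t) (w t - v) ≤
      (bregmanDiv F v (w t) - bregmanDiv F v (w (t + 1))) + B t := by
    intro t ht
    obtain ⟨w', hw', hgrad, hmem, hmin⟩ := hrun.update t (Finset.mem_range.1 ht)
    have hpyth := bregmanDiv_add_bregmanDiv_le_of_isMinOn
      (openSegment_subset_convexHull_inter_interior hF.1 hmem hvS hvD) (hdiff _ hmem.2) hmin
    have hnonneg := bregmanDiv_nonneg hF (interior_subset hmem.2) (interior_subset hw')
      (hdiff _ hw')
    have hcost := hB t (Finset.mem_range.1 ht) w' hw' hgrad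
    have hthree := bregmanDiv_three_point F v (w t) w'
    rw [hgrad, sub_sub_cancel] at hthree
    linarith
  have hlast : 0 ≤ bregmanDiv F v (w n) :=
    bregmanDiv_nonneg hF hvD (interior_subset (hrun.mem le_rfl).2) (hdiff _ (hrun.mem le_rfl).2)
  have hsum := Finset.sum_le_sum hround
  rw [Finset.sum_add_distrib, Finset.sum_range_sub'] at hsum
  linarith

end Bregman

/-! ### The potential of linpoly -/

section Linpoly

variable {d : ℕ} {q η : ℝ}

theorem convex_nonnegOrthant (d : ℕ) : Convex ℝ (nonnegOrthant d) :=
  fun _ hx _ hy _ _ ha hb _ i => add_nonneg (mul_nonneg ha (hx i)) (mul_nonneg hb (hy i))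

theorem interior_nonnegOrthant (d : ℕ) :
    interior (nonnegOrthant d) = {u : EuclideanSpace ℝ (Fin d) | ∀ i, 0 < u i} := by
  refine Set.Subset.antisymm (fun u hu i => ?_) (interior_maximal (fun u hu i => (hu i).le) ?_)
  · have hcont : Continuous fun s : ℝ => u - s • EuclideanSpace.single i (1 : ℝ) := by fun_prop
    have hnear : ∀ᶠ s in nhds (0 : ℝ), u - s • EuclideanSpace.single i (1 : ℝ) ∈ nonnegOrthant d :=
      hcont.continuousAt.eventually_mem (by simpa using mem_interior_iff_mem_nhds.1 hu)
    obtain ⟨s, hmem, hs⟩ := (hnear.filter_mono nhdsWithin_le_nhds |>.and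
      (self_mem_nhdsWithin (s := Set.Ioi (0 : ℝ)))).exists
    have hs' : s ≤ u i := by simpa using hmem i
    exact lt_of_lt_of_le hs hs'
  · simp only [Set.ofPred_forall]
    exact isOpen_iInter_of_finite fun i => isOpen_lt continuous_const (by fun_prop)

theorem onesVec_pos (d : ℕ) (i : Fin d) : 0 < onesVec d i := by simp [onesVec]

theorem hasGradientAt_linpolyPotential (hq : 1 < q) (η : ℝ) {w : EuclideanSpace ℝ (Fin d)}
    (hw : ∀ i, 0 < w i) :
    HasGradientAt (linpolyPotential q η)
      (WithLp.toLp 2 fun i => -(η⁻¹ * w i ^ (-(1 / q)))) w := by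
  have hq1 : q - 1 ≠ 0 := by linarith
  have hq0 : q ≠ 0 := by linarith
  have hcoord : ∀ i ∈ Finset.univ, HasFDerivAt
      (fun u : EuclideanSpace ℝ (Fin d) => u i ^ ((q - 1) / q))
      (((q - 1) / q * w i ^ ((q - 1) / q - 1)) •
        (EuclideanSpace.proj i : EuclideanSpace ℝ (Fin d) →L[ℝ] ℝ)) w := fun i _ =>
    (EuclideanSpace.proj i : EuclideanSpace ℝ (Fin d) →L[ℝ] ℝ).hasFDerivAt.rpow_const
      (Or.inl (hw i).ne')
  rw [hasGradientAt_iff_hasFDerivAt]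
  refine ((HasFDerivAt.fun_sum hcoord).const_mul (-(q / ((q - 1) * η)))).congr_fderiv ?_
  ext v
  simp only [smul_apply, sum_apply, smul_eq_mul, InnerProductSpace.toDual_apply_apply,
    PiLp.inner_apply, Finset.mul_sum, PiLp.proj_apply, RCLike.inner_apply, conj_trivial]
  refine Finset.sum_congr rfl fun i _ => ?_
  rw [show (q - 1) / q - 1 = -(1 / q) by field_simp; ring, ← div_div, div_eq_mul_inv _ η]
  field_simp

theorem gradient_linpolyPotential (hq : 1 < q) (η : ℝ) {w : EuclideanSpace ℝ (Fin d)}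
    (hw : ∀ i, 0 < w i) :
    gradient (linpolyPotential q η) w = WithLp.toLp 2 fun i => -(η⁻¹ * w i ^ (-(1 / q))) :=
  (hasGradientAt_linpolyPotential hq η hw).gradient

theorem convexOn_linpolyPotential (hq : 1 < q) (hη : 0 ≤ η) :
    ConvexOn ℝ (nonnegOrthant d) (linpolyPotential q η) := by
  have hconcave : ConcaveOn ℝ (nonnegOrthant d) fun u => ∑ i, u i ^ ((q - 1) / q) := by
    refine ⟨convex_nonnegOrthant d, fun x hx y hy a b ha hb hab => ?_⟩
    simp only [smul_eq_mul, Finset.mul_sum, ← Finset.sum_add_distrib]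
    refine Finset.sum_le_sum fun i _ => ?_
    exact (Real.concaveOn_rpow (by positivity) (by rw [div_le_one] <;> linarith)).2 (hx i) (hy i)
      ha hb hab
  have hconvex := hconcave.neg.smul (c := q / ((q - 1) * η)) (by positivity)
  refine hconvex.congr fun u _ => ?_
  simp [linpolyPotential]

/-- The Bregman divergence of `x ↦ -(q / (q - 1)) x ^ ((q - 1) / q)` on the half-line, to which the
divergence of the linpoly potential reduces coordinate by coordinate. -/
noncomputable def powerDiv (q x y : ℝ) : ℝ :=
  q / (q - 1) * (y ^ ((q - 1) / q) - x ^ ((q - 1) / q)) + (x - y) * y ^ (-(1 / q))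

theorem bregmanDiv_linpolyPotential (hq : 1 < q) (u : EuclideanSpace ℝ (Fin d))
    {w : EuclideanSpace ℝ (Fin d)} (hw : ∀ i, 0 < w i) :
    bregmanDiv (linpolyPotential q η) u w = η⁻¹ * ∑ i, powerDiv q (u i) (w i) := by
  rw [bregmanDiv, gradient_linpolyPotential hq η hw]
  simp only [linpolyPotential, powerDiv, PiLp.inner_apply, RCLike.inner_apply, conj_trivial,
    PiLp.sub_apply, Finset.mul_sum, ← Finset.sum_sub_distrib]
  refine Finset.sum_congr rfl fun i _ => ?_
  rw [← div_div, div_eq_mul_inv _ η]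
  ring

theorem powerDiv_one_le (hq : 1 < q) {x : ℝ} (hx : x ∈ Set.Icc 0 1) :
    powerDiv q x 1 ≤ (q - 1)⁻¹ := by
  have hq1 : 0 < q - 1 := by linarith
  have hle : x ≤ x ^ ((q - 1) / q) :=
    Real.self_le_rpow_of_le_one hx.1 hx.2 (by rw [div_le_one] <;> linarith)
  have hcoef : q / (q - 1) = 1 + (q - 1)⁻¹ := by field_simp; ring
  rw [powerDiv, Real.one_rpow, Real.one_rpow, hcoef, mul_one]
  nlinarith [inv_pos.2 hq1, hx.1, mul_le_mul_of_nonneg_left (hx.1.trans hle) (inv_pos.2 hq1).le]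

theorem bregmanDiv_linpolyPotential_onesVec_le (hq : 1 < q) (hη : 0 ≤ η)
    {v : EuclideanSpace ℝ (Fin d)} (hv : ∀ i, v i ∈ Set.Icc (0 : ℝ) 1) :
    bregmanDiv (linpolyPotential q η) v (onesVec d) ≤ d / ((q - 1) * η) := by
  have hsum : ∑ i, powerDiv q (v i) (onesVec d i) ≤ ∑ _i : Fin d, (q - 1)⁻¹ :=
    Finset.sum_le_sum fun i _ => powerDiv_one_le hq (hv i)
  rw [bregmanDiv_linpolyPotential hq v (onesVec_pos d)]
  calc η⁻¹ * ∑ i, powerDiv q (v i) (onesVec d i) ≤ η⁻¹ * (d * (q - 1)⁻¹) := by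
        gcongr
        simpa using hsum
    _ = d / ((q - 1) * η) := by rw [div_eq_mul_inv, mul_inv]; ring

theorem powerDiv_rpow_neg (hq : 1 < q) {a b : ℝ} (ha : 0 < a) (hb : 0 < b) :
    powerDiv q (a ^ (-q)) (b ^ (-q)) =
      a ^ (1 - q) / (q - 1) * ((b / a) ^ (1 - q) - q + (q - 1) * (b / a)) := by
  have hq1 : q - 1 ≠ 0 := by linarith
  have hq0 : q ≠ 0 := by linarith
  have hinv : (b ^ (-q)) ^ (-(1 / q)) = b := by
    rw [← Real.rpow_mul hb.le, show -q * -(1 / q) = 1 by field_simp, Real.rpow_one]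
  have hexp : -q * ((q - 1) / q) = 1 - q := by field_simp; ring
  have hsucc : ∀ x : ℝ, 0 < x → x ^ (-q) = x ^ (1 - q) / x := fun x hx => by
    rw [← Real.rpow_sub_one hx.ne', show 1 - q - 1 = -q by ring]
  rw [powerDiv, hinv, ← Real.rpow_mul ha.le, ← Real.rpow_mul hb.le, hexp, hsucc a ha, hsucc b hb,
    Real.div_rpow hb.le ha.le]
  field_simp
  ring

theorem powerDiv_le (hq : 1 < q) {x y z : ℝ} (hx : 0 < x) (hy : 0 < y) (hz : 0 ≤ z)
    (hxy : y ^ (-(1 / q)) = x ^ (-(1 / q)) + z) :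
    powerDiv q x y ≤ q / 2 * (x ^ (1 + 1 / q) * z ^ 2) := by
  have hq1 : 0 < q - 1 := by linarith
  have hq0 : q ≠ 0 := by linarith
  have hdual : ∀ r : ℝ, 0 < r → (r ^ (-(1 / q))) ^ (-q) = r := fun r hr => by
    rw [← Real.rpow_mul hr.le, show -(1 / q) * -q = 1 by field_simp, Real.rpow_one]
  have ha0 : 0 < x ^ (-(1 / q)) := by positivity
  have hb0 : 0 < y ^ (-(1 / q)) := by positivity
  have hweight : x ^ (1 + 1 / q) = (x ^ (-(1 / q))) ^ (1 - q) / (x ^ (-(1 / q))) ^ 2 := by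
    rw [← Real.rpow_mul hx.le, ← Real.rpow_natCast, ← Real.rpow_mul hx.le, ← Real.rpow_sub hx]
    congr 1
    push_cast
    field_simp
    ring
  have hdiv := powerDiv_rpow_neg hq ha0 hb0
  rw [hdual x hx, hdual y hy, hxy] at hdiv
  rw [hdiv, hweight]
  set a := x ^ (-(1 / q))
  have htaylor := one_add_rpow_neg_le hq1.le (by positivity : 0 ≤ z / a)
  rw [neg_sub, sub_add_cancel] at htaylor
  rw [show (a + z) / a = 1 + z / a by field_simp]
  calc a ^ (1 - q) / (q - 1) * ((1 + z / a) ^ (1 - q) - q + (q - 1) * (1 + z / a))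
      ≤ a ^ (1 - q) / (q - 1) * ((q - 1) * q / 2 * (z / a) ^ 2) := by
        gcongr
        linarith
    _ = q / 2 * (a ^ (1 - q) / a ^ 2 * z ^ 2) := by field_simp

/-- The squared norm of a gradient step `z` that is dual to the Hessian of the linpoly potential at
`w`, up to the factor `η q`. It measures the cost of one round. -/
noncomputable def dualLocalNormSq (q : ℝ) (w z : EuclideanSpace ℝ (Fin d)) : ℝ :=
  ∑ i, w i ^ (1 + 1 / q) * z i ^ 2

theorem bregmanDiv_linpolyPotential_le (hq : 1 < q) (hη : 0 < η)
    {w w' z : EuclideanSpace ℝ (Fin d)} (hw : ∀ i, 0 < w i) (hw' : ∀ i, 0 < w' i)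
    (hz : ∀ i, 0 ≤ z i)
    (h : gradient (linpolyPotential q η) w' = gradient (linpolyPotential q η) w - z) :
    bregmanDiv (linpolyPotential q η) w w' ≤ η * q / 2 * dualLocalNormSq q w z := by
  rw [gradient_linpolyPotential hq η hw, gradient_linpolyPotential hq η hw'] at h
  have hstep : ∀ i, w' i ^ (-(1 / q)) = w i ^ (-(1 / q)) + η * z i := fun i => by
    have hi := congrArg (fun x : EuclideanSpace ℝ (Fin d) => x i) h
    simp only [PiLp.sub_apply] at hi
    field_simp at hi ⊢
    linarith
  rw [bregmanDiv_linpolyPotential hq w hw']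
  calc η⁻¹ * ∑ i, powerDiv q (w i) (w' i)
      ≤ η⁻¹ * ∑ i, q / 2 * (w i ^ (1 + 1 / q) * (η * z i) ^ 2) := by
        gcongr with i
        exact powerDiv_le hq (hw i) (hw' i) (mul_nonneg hη.le (hz i)) (hstep i)
    _ = η * q / 2 * dualLocalNormSq q w z := by
        rw [dualLocalNormSq, Finset.mul_sum, Finset.mul_sum]
        refine Finset.sum_congr rfl fun i _ => ?_
        field_simp

theorem inner_importanceWeightedEst_self (l v : EuclideanSpace ℝ (Fin d))
    {w : EuclideanSpace ℝ (Fin d)} (hw : ∀ i, w i ≠ 0) :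
    inner ℝ (importanceWeightedEst l v w) w = inner ℝ l v := by
  simp only [importanceWeightedEst, PiLp.inner_apply, RCLike.inner_apply, conj_trivial]
  refine Finset.sum_congr rfl fun i _ => ?_
  have := hw i
  field_simp

variable {F : EuclideanSpace ℝ (Fin d) → ℝ} {S : Finset (EuclideanSpace ℝ (Fin d))} {n : ℕ}
  {w : ℕ → EuclideanSpace ℝ (Fin d)} {p : ℕ → EuclideanSpace ℝ (Fin d) → ℝ}
  {z V l : ℕ → EuclideanSpace ℝ (Fin d)}

theorem IsCLEBRun.weight_pos (hrun : IsCLEBRun (nonnegOrthant d) F S n w p z) {t : ℕ}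
    (ht : t ≤ n) (i : Fin d) : 0 < w t i := by
  have hmem := (hrun.mem ht).2
  rw [interior_nonnegOrthant] at hmem
  exact hmem i

theorem IsLinpolyRun.bregmanDiv_init_le (hrun : IsLinpolyRun q η S n w p V l) (hq : 1 < q)
    (hη : 0 ≤ η) {v : EuclideanSpace ℝ (Fin d)} (hvS : v ∈ S)
    (hv : ∀ i, v i ∈ Set.Icc (0 : ℝ) 1) :
    bregmanDiv (linpolyPotential q η) v (w 0) ≤ d / ((q - 1) * η) := by
  have hw0 := hrun.cleb.weight_pos n.zero_le
  have hdiff := (hasGradientAt_linpolyPotential hq η hw0).differentiableAt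
  have hconv := convexOn_linpolyPotential (d := d) hq hη
  have hpyth := bregmanDiv_add_bregmanDiv_le_of_isMinOn
    ((convex_convexHull ℝ _).openSegment_subset hrun.cleb.init_mem.1 (subset_convexHull ℝ _ hvS))
    hdiff hrun.init_min
  have hnonneg := bregmanDiv_nonneg hconv (fun i => (hw0 i).le) (fun i => (onesVec_pos d i).le)
    (hasGradientAt_linpolyPotential hq η (onesVec_pos d)).differentiableAt
  linarith [bregmanDiv_linpolyPotential_onesVec_le hq hη hv]

theorem IsLinpolyRun.sum_inner_sub_inner_le (hrun : IsLinpolyRun q η S n w p V l) (hq : 1 < q)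
    (hη : 0 < η) (hl : ∀ t < n, ∀ i, 0 ≤ l t i) (hV : ∀ t < n, ∀ i, 0 ≤ V t i)
    {v : EuclideanSpace ℝ (Fin d)} (hvS : v ∈ S) (hv : ∀ i, v i ∈ Set.Icc (0 : ℝ) 1) :
    ∑ t ∈ Finset.range n,
        (inner ℝ (l t) (V t) - inner ℝ (importanceWeightedEst (l t) (V t) (w t)) v) ≤
      d / ((q - 1) * η) + η * q / 2 *
        ∑ t ∈ Finset.range n,
          dualLocalNormSq q (w t) (importanceWeightedEst (l t) (V t) (w t)) := by
  have hpos : ∀ x ∈ interior (nonnegOrthant d), ∀ i, 0 < x i := fun x hx => by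
    rwa [interior_nonnegOrthant] at hx
  have hest : ∀ t < n, ∀ i, 0 ≤ importanceWeightedEst (l t) (V t) (w t) i := fun t ht i =>
    mul_nonneg (hl t ht i) (div_nonneg (hV t ht i) (hrun.cleb.weight_pos ht.le i).le)
  have hregret := hrun.cleb.sum_inner_sub_le (convexOn_linpolyPotential hq hη.le)
    (fun x hx => (hasGradientAt_linpolyPotential hq η (hpos x hx)).differentiableAt) hvS
    (fun i => (hv i).1) fun t ht w' hw' hgrad =>
      bregmanDiv_linpolyPotential_le hq hη (hrun.cleb.weight_pos ht.le) (hpos w' hw') (hest t ht)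
        hgrad
  rw [← Finset.mul_sum] at hregret
  refine le_trans (le_of_eq (Finset.sum_congr rfl fun t ht => ?_))
    (hregret.trans (add_le_add_left (hrun.bregmanDiv_init_le hq hη.le hvS hv) _))
  rw [inner_sub_right, inner_importanceWeightedEst_self _ _
    fun i => (hrun.cleb.weight_pos (Finset.mem_range.1 ht).le i).ne']

end Linpoly

/-! ### Conditional laws with finite support -/

section ConditionalLaw

variable {Ω : Type*} {m mΩ : MeasurableSpace Ω} {P : Measure Ω}

theorem lintegral_condLExp_mul (hm : m ≤ mΩ) [SigmaFinite (P.trim hm)] {X g : Ω → ENNReal}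
    (hX : Measurable X) (hg : Measurable[m] g) :
    ∫⁻ ω, P⁻[X|m] ω * g ω ∂P = ∫⁻ ω, X ω * g ω ∂P := by
  have hX' : Measurable P⁻[X|m] := (measurable_condLExp m P X).mono hm le_rfl
  have htrim : (P.withDensity P⁻[X|m]).trim hm = (P.withDensity X).trim hm := by
    refine @Measure.ext _ m _ _ fun s hs => ?_
    rw [trim_measurableSet_eq hm hs, trim_measurableSet_eq hm hs, withDensity_apply _ (hm s hs),
      withDensity_apply _ (hm s hs), setLIntegral_condLExp hm P X hs]
  calc ∫⁻ ω, P⁻[X|m] ω * g ω ∂P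
      = ∫⁻ ω, g ω ∂P.withDensity P⁻[X|m] :=
        (lintegral_withDensity_eq_lintegral_mul _ hX' (hg.mono hm le_rfl)).symm
    _ = ∫⁻ ω, g ω ∂P.withDensity X := by rw [← lintegral_trim hm hg, htrim, lintegral_trim hm hg]
    _ = ∫⁻ ω, X ω * g ω ∂P := lintegral_withDensity_eq_lintegral_mul _ hX (hg.mono hm le_rfl)

theorem lintegral_indicator_eq_of_condExp [IsFiniteMeasure P] (hm : m ≤ mΩ) {A : Set Ω}
    (hA : MeasurableSet A) {f : Ω → ℝ} (hf : P[A.indicator (fun _ => (1 : ℝ)) | m] =ᵐ[P] f)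
    {g : Ω → ENNReal} (hg : Measurable[m] g) :
    ∫⁻ ω, A.indicator g ω ∂P = ∫⁻ ω, ENNReal.ofReal (f ω) * g ω ∂P := by
  let X : Ω → ℝ := A.indicator fun _ => 1
  have hX : Measurable X := measurable_const.indicator hA
  have hX0 : 0 ≤ X := Set.indicator_nonneg fun _ _ => zero_le_one
  have hcond : P⁻[fun ω => ENNReal.ofReal (X ω)|m] =ᵐ[P] fun ω => ENNReal.ofReal (f ω) := by
    filter_upwards [condLExp_ofReal m ((integrable_const (1 : ℝ)).indicator hA)
      (ae_of_all P hX0), hf] with ω h1 h2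
    rw [h1, h2]
  calc ∫⁻ ω, A.indicator g ω ∂P = ∫⁻ ω, ENNReal.ofReal (X ω) * g ω ∂P := by
        refine lintegral_congr fun ω => ?_
        by_cases hω : ω ∈ A <;> simp [X, hω]
    _ = ∫⁻ ω, P⁻[fun ω => ENNReal.ofReal (X ω)|m] ω * g ω ∂P :=
        (lintegral_condLExp_mul hm hX.ennreal_ofReal hg).symm
    _ = ∫⁻ ω, ENNReal.ofReal (f ω) * g ω ∂P := lintegral_congr_ae (hcond.mul (ae_eq_refl g))

variable {α : Type*} {S : Finset α} {V : Ω → α}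

theorem apply_eq_sum_indicator_preimage {M : Type*} [AddCommMonoid M] (hVS : ∀ ω, V ω ∈ S)
    (f : Ω → α → M) (ω : Ω) :
    f ω (V ω) = ∑ v ∈ S, (V ⁻¹' {v}).indicator (fun ω => f ω v) ω := by
  have hzero : ∀ v ∈ S, v ≠ V ω → (V ⁻¹' {v}).indicator (fun ω => f ω v) ω = 0 :=
    fun v _ hne => Set.indicator_of_notMem (fun hω => hne (Eq.symm hω)) _
  rw [Finset.sum_eq_single_of_mem _ (hVS ω) hzero]
  simp

variable [MeasurableSpace α] [MeasurableSingletonClass α]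

theorem measurable_apply_of_mem_finset {M : Type*} [AddCommMonoid M] [MeasurableSpace M]
    [MeasurableAdd₂ M] (hV : Measurable V) (hVS : ∀ ω, V ω ∈ S) {f : Ω → α → M}
    (hf : ∀ v ∈ S, Measurable fun ω => f ω v) : Measurable fun ω => f ω (V ω) := by
  simp_rw [apply_eq_sum_indicator_preimage hVS f]
  exact Finset.measurable_fun_sum S fun v hv =>
    (hf v hv).indicator (hV (measurableSet_singleton v))

variable [IsFiniteMeasure P] {p : Ω → α → ℝ}

theorem lintegral_apply_eq_lintegral_sum_of_condExp (hm : m ≤ mΩ) (hV : Measurable V)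
    (hVS : ∀ ω, V ω ∈ S)
    (hp : ∀ v ∈ S, P[(V ⁻¹' {v}).indicator (fun _ => (1 : ℝ)) | m] =ᵐ[P] fun ω => p ω v)
    {f : Ω → α → ENNReal} (hf : ∀ v ∈ S, Measurable[m] fun ω => f ω v) :
    ∫⁻ ω, f ω (V ω) ∂P = ∫⁻ ω, ∑ v ∈ S, ENNReal.ofReal (p ω v) * f ω v ∂P := by
  have hf' : ∀ v ∈ S, Measurable fun ω => f ω v := fun v hv => (hf v hv).mono hm le_rfl
  have hA : ∀ v, MeasurableSet (V ⁻¹' {v}) := fun v => hV (measurableSet_singleton v)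
  have hp' : ∀ v ∈ S, AEMeasurable (fun ω => p ω v) P := fun v hv =>
    integrable_condExp.aestronglyMeasurable.aemeasurable.congr (hp v hv)
  have hpf : ∀ v ∈ S, AEMeasurable (fun ω => ENNReal.ofReal (p ω v) * f ω v) P := fun v hv =>
    (hp' v hv).ennreal_ofReal.mul (hf' v hv).aemeasurable
  simp_rw [apply_eq_sum_indicator_preimage hVS f]
  rw [lintegral_finsetSum _ fun v hv => (hf' v hv).indicator (hA v),
    lintegral_finsetSum' _ hpf]
  exact Finset.sum_congr rfl fun v hv =>
    lintegral_indicator_eq_of_condExp hm (hA v) (hp v hv) (hf v hv)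

theorem integrable_apply_and_integral_eq_of_condExp (hm : m ≤ mΩ) (hV : Measurable V)
    (hVS : ∀ ω, V ω ∈ S)
    (hp : ∀ v ∈ S, P[(V ⁻¹' {v}).indicator (fun _ => (1 : ℝ)) | m] =ᵐ[P] fun ω => p ω v)
    (hp0 : ∀ ω, ∀ v ∈ S, 0 ≤ p ω v) {f : Ω → α → ℝ}
    (hf : ∀ v ∈ S, Measurable[m] fun ω => f ω v) (hf0 : ∀ ω, ∀ v ∈ S, 0 ≤ f ω v)
    (hint : Integrable (fun ω => ∑ v ∈ S, p ω v * f ω v) P) :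
    Integrable (fun ω => f ω (V ω)) P ∧
      ∫ ω, f ω (V ω) ∂P = ∫ ω, ∑ v ∈ S, p ω v * f ω v ∂P := by
  have hmeas : AEStronglyMeasurable (fun ω => f ω (V ω)) P :=
    (measurable_apply_of_mem_finset hV hVS
      fun v hv => (hf v hv).mono hm le_rfl).aestronglyMeasurable
  have hfV0 : ∀ ω, 0 ≤ f ω (V ω) := fun ω => hf0 ω _ (hVS ω)
  have hpf0 : ∀ ω, ∀ v ∈ S, 0 ≤ p ω v * f ω v := fun ω v hv => mul_nonneg (hp0 ω v hv) (hf0 ω v hv)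
  have hsum0 : ∀ ω, 0 ≤ ∑ v ∈ S, p ω v * f ω v := fun ω => Finset.sum_nonneg (hpf0 ω)
  have hlint : ∫⁻ ω, ENNReal.ofReal (f ω (V ω)) ∂P =
      ∫⁻ ω, ENNReal.ofReal (∑ v ∈ S, p ω v * f ω v) ∂P := by
    rw [lintegral_apply_eq_lintegral_sum_of_condExp hm hV hVS hp
      (f := fun ω v => ENNReal.ofReal (f ω v)) fun v hv => (hf v hv).ennreal_ofReal]
    refine lintegral_congr fun ω => ?_
    rw [ENNReal.ofReal_sum_of_nonneg (hpf0 ω)]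
    exact Finset.sum_congr rfl fun v hv => (ENNReal.ofReal_mul (hp0 ω v hv)).symm
  constructor
  · refine ⟨hmeas, ?_⟩
    rw [hasFiniteIntegral_iff_ofReal (ae_of_all _ hfV0), hlint,
      ← hasFiniteIntegral_iff_ofReal (ae_of_all _ hsum0)]
    exact hint.2
  · rw [integral_eq_lintegral_of_nonneg_ae (ae_of_all _ hfV0) hmeas, hlint,
      ← integral_eq_lintegral_of_nonneg_ae (ae_of_all _ hsum0) hint.1]

end ConditionalLaw

/-! ### One round of the game -/

section Round

variable {d : ℕ} {S : Finset (EuclideanSpace ℝ (Fin d))} {p : EuclideanSpace ℝ (Fin d) → ℝ}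
  {l w : EuclideanSpace ℝ (Fin d)}

theorem inner_nonneg_of_nonneg {u v : EuclideanSpace ℝ (Fin d)} (hu : ∀ i, 0 ≤ u i)
    (hv : ∀ i, 0 ≤ v i) : 0 ≤ inner ℝ u v := by
  simp only [PiLp.inner_apply, RCLike.inner_apply, conj_trivial]
  exact Finset.sum_nonneg fun i _ => mul_nonneg (hv i) (hu i)

theorem apply_le_one_of_inner_le_one {v : EuclideanSpace ℝ (Fin d)} (hl : ∀ i, 0 ≤ l i)
    (hv : ∀ i, 0 ≤ v i) (hlv : inner ℝ l v ≤ 1) {i : Fin d} (hi : v i = 1) : l i ≤ 1 := by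
  simp only [PiLp.inner_apply, RCLike.inner_apply, conj_trivial] at hlv
  have hterm := Finset.single_le_sum (fun j _ => mul_nonneg (hv j) (hl j)) (Finset.mem_univ i)
  rw [hi, one_mul] at hterm
  exact hterm.trans hlv

theorem inner_le_one_of_mem_convexHull (hl : ∀ v ∈ S, inner ℝ l v ≤ 1)
    (hw : w ∈ convexHull ℝ (S : Set (EuclideanSpace ℝ (Fin d)))) : inner ℝ l w ≤ 1 :=
  convexHull_min (t := {u | inner ℝ l u ≤ 1}) hl
    (convex_halfSpace_le (innerₗ _ l).isLinear 1) hw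

theorem sum_mul_apply_eq (hmean : ∑ v ∈ S, p v • v = w) (i : Fin d) :
    ∑ v ∈ S, p v * v i = w i := by
  simp [← hmean]

theorem sum_mul_inner_importanceWeightedEst (hmean : ∑ v ∈ S, p v • v = w) (hw : ∀ i, w i ≠ 0)
    (u : EuclideanSpace ℝ (Fin d)) :
    ∑ v ∈ S, p v * inner ℝ (importanceWeightedEst l v w) u = inner ℝ l u := by
  simp only [importanceWeightedEst, PiLp.inner_apply, RCLike.inner_apply, conj_trivial,
    Finset.mul_sum]
  rw [Finset.sum_comm]
  refine Finset.sum_congr rfl fun i _ => ?_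
  calc ∑ v ∈ S, p v * (u i * (l i * (v i / w i)))
      = u i * l i / w i * ∑ v ∈ S, p v * v i := by
        rw [Finset.mul_sum]
        exact Finset.sum_congr rfl fun v _ => by ring
    _ = u i * l i := by rw [sum_mul_apply_eq hmean, div_mul_cancel₀ _ (hw i)]

theorem dualLocalNormSq_nonneg (q : ℝ) {w : EuclideanSpace ℝ (Fin d)} (hw : ∀ i, 0 ≤ w i)
    (z : EuclideanSpace ℝ (Fin d)) : 0 ≤ dualLocalNormSq q w z :=
  Finset.sum_nonneg fun i _ => mul_nonneg (Real.rpow_nonneg (hw i) _) (sq_nonneg _)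

theorem dualLocalNormSq_importanceWeightedEst_le (q : ℝ) (l : EuclideanSpace ℝ (Fin d))
    {v w : EuclideanSpace ℝ (Fin d)} (hv : ∀ i, v i ∈ Set.Icc (0 : ℝ) 1) (hw : ∀ i, 0 < w i) :
    dualLocalNormSq q w (importanceWeightedEst l v w) ≤
      ∑ i, l i ^ 2 * w i ^ (1 / q) / w i * v i := by
  refine Finset.sum_le_sum fun i _ => ?_
  have hwi := hw i
  have hsq : v i ^ 2 ≤ v i := pow_le_of_le_one (hv i).1 (hv i).2 two_ne_zero
  calc w i ^ (1 + 1 / q) * (l i * (v i / w i)) ^ 2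
      = l i ^ 2 * w i ^ (1 / q) / w i * v i ^ 2 := by
        rw [Real.rpow_add hwi, Real.rpow_one]
        field_simp
    _ ≤ l i ^ 2 * w i ^ (1 / q) / w i * v i := by gcongr

theorem sum_mul_dualLocalNormSq_importanceWeightedEst_le {q : ℝ} (hq : 1 ≤ q)
    (hS : ∀ v ∈ S, ∀ i, v i ∈ Set.Icc (0 : ℝ) 1) (hp : ∀ v ∈ S, 0 ≤ p v)
    (hmean : ∑ v ∈ S, p v • v = w) (hw : ∀ i, 0 < w i) (hl : ∀ i, l i ∈ Set.Icc (0 : ℝ) 1)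
    (hlw : inner ℝ l w ≤ 1) :
    ∑ v ∈ S, p v * dualLocalNormSq q w (importanceWeightedEst l v w) ≤
      (d : ℝ) ^ (1 - 1 / q) := by
  have hlw' : ∑ i, l i * w i ≤ 1 := by
    simpa only [PiLp.inner_apply, RCLike.inner_apply, conj_trivial, mul_comm] using hlw
  calc ∑ v ∈ S, p v * dualLocalNormSq q w (importanceWeightedEst l v w)
      ≤ ∑ v ∈ S, p v * ∑ i, l i ^ 2 * w i ^ (1 / q) / w i * v i :=
        Finset.sum_le_sum fun v hv => mul_le_mul_of_nonneg_left
          (dualLocalNormSq_importanceWeightedEst_le q l (hS v hv) hw) (hp v hv)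
    _ = ∑ i, l i ^ 2 * w i ^ (1 / q) / w i * ∑ v ∈ S, p v * v i := by
        simp only [Finset.mul_sum]
        rw [Finset.sum_comm]
        exact Finset.sum_congr rfl fun i _ => Finset.sum_congr rfl fun v _ => mul_left_comm _ _ _
    _ = ∑ i, l i ^ 2 * w i ^ (1 / q) := Finset.sum_congr rfl fun i _ => by
        rw [sum_mul_apply_eq hmean, div_mul_cancel₀ _ (hw i).ne']
    _ ≤ (d : ℝ) ^ (1 - 1 / q) := by
        simpa using sum_sq_mul_rpow_le Finset.univ hq (fun i _ => hl i) (fun i _ => (hw i).le) hlw'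

end Round

section Measurability

variable {d : ℕ} {Ω : Type*} {m : MeasurableSpace Ω} {l w z : Ω → EuclideanSpace ℝ (Fin d)}

theorem measurable_importanceWeightedEst (hl : Measurable l) (hw : Measurable w)
    (v : EuclideanSpace ℝ (Fin d)) :
    Measurable fun ω => importanceWeightedEst (l ω) v (w ω) := by
  unfold importanceWeightedEst
  fun_prop

theorem measurable_dualLocalNormSq (q : ℝ) (hw : Measurable w) (hz : Measurable z) :
    Measurable fun ω => dualLocalNormSq q (w ω) (z ω) := by
  unfold dualLocalNormSq
  fun_prop

end Measurability

section Game

variable {d : ℕ} {Ω : Type*} {mΩ : MeasurableSpace Ω} {P : Measure Ω} {ℱ : Filtration ℕ mΩ}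
  {S : Finset (EuclideanSpace ℝ (Fin d))} {n t : ℕ} {p : ℕ → Ω → EuclideanSpace ℝ (Fin d) → ℝ}
  {V l : ℕ → Ω → EuclideanSpace ℝ (Fin d)}

/-- The σ-algebra of the information present in round `t` when the loss vector has been selected but
the action has not yet been drawn. Conditionally on it, the action has distribution `p t`. -/
abbrev preDraw (ℱ : Filtration ℕ mΩ) (l : ℕ → Ω → EuclideanSpace ℝ (Fin d)) (t : ℕ) :
    MeasurableSpace Ω :=
  ℱ t ⊔ MeasurableSpace.comap (l t) inferInstance

theorem measurable_preDraw_loss : Measurable[preDraw ℱ l t] (l t) :=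
  (comap_measurable (l t)).mono le_sup_right le_rfl

theorem IsPredictionGame.preDraw_le (hgame : IsPredictionGame P ℱ S n p V l) (ht : t < n) :
    preDraw ℱ l t ≤ mΩ :=
  sup_le (ℱ.le t) ((hgame.l_meas t ht).mono (ℱ.le _) le_rfl).comap_le

theorem IsPredictionGame.measurable_action (hgame : IsPredictionGame P ℱ S n p V l) (ht : t < n) :
    Measurable (V t) :=
  (hgame.V_meas t ht).mono (ℱ.le _) le_rfl

theorem IsPredictionGame.measurable_loss (hgame : IsPredictionGame P ℱ S n p V l) (ht : t < n) :
    Measurable (l t) :=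
  (hgame.l_meas t ht).mono (ℱ.le _) le_rfl

theorem IsPredictionGame.measurable_preDraw_mean (hgame : IsPredictionGame P ℱ S n p V l)
    (ht : t < n) : Measurable[preDraw ℱ l t] fun ω => ∑ v ∈ S, p t ω v • v :=
  (Finset.measurable_fun_sum S fun v hv => (hgame.p_meas t ht v hv).smul_const v).mono
    le_sup_left le_rfl

theorem IsPredictionGame.integrable_inner_loss [IsFiniteMeasure P]
    (hgame : IsPredictionGame P ℱ S n p V l) (ht : t < n) (hS : ∀ v ∈ S, ∀ i, 0 ≤ v i)
    (hL2 : ∀ ω, ∀ v ∈ S, inner ℝ (l t ω) v ≤ 1) {u : Ω → EuclideanSpace ℝ (Fin d)}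
    (hu : Measurable u) (huS : ∀ ω, u ω ∈ S) : Integrable (fun ω => inner ℝ (l t ω) (u ω)) P := by
  refine Integrable.of_bound ((hgame.measurable_loss ht).inner hu).aestronglyMeasurable 1
    (ae_of_all _ fun ω => ?_)
  rw [Real.norm_of_nonneg (inner_nonneg_of_nonneg (hgame.l_nonneg t ht ω) (hS _ (huS ω)))]
  exact hL2 ω _ (huS ω)

theorem IsPredictionGame.integrable_apply_and_integral_eq [IsFiniteMeasure P]
    (hgame : IsPredictionGame P ℱ S n p V l) (ht : t < n) (hp0 : ∀ ω, ∀ v ∈ S, 0 ≤ p t ω v)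
    {f : Ω → EuclideanSpace ℝ (Fin d) → ℝ}
    (hf : ∀ v ∈ S, Measurable[preDraw ℱ l t] fun ω => f ω v) (hf0 : ∀ ω, ∀ v ∈ S, 0 ≤ f ω v)
    (hint : Integrable (fun ω => ∑ v ∈ S, p t ω v * f ω v) P) :
    Integrable (fun ω => f ω (V t ω)) P ∧
      ∫ ω, f ω (V t ω) ∂P = ∫ ω, ∑ v ∈ S, p t ω v * f ω v ∂P :=
  integrable_apply_and_integral_eq_of_condExp (hgame.preDraw_le ht) (hgame.measurable_action ht)
    (hgame.V_mem t ht) (hgame.draw t ht) hp0 hf hf0 hint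

variable {F : EuclideanSpace ℝ (Fin d) → ℝ} {w z : ℕ → Ω → EuclideanSpace ℝ (Fin d)}

theorem IsPredictionGame.measurable_preDraw_weight (hgame : IsPredictionGame P ℱ S n p V l)
    (ht : t < n) {D : Set (EuclideanSpace ℝ (Fin d))}
    (hrun : ∀ ω, IsCLEBRun D F S n (fun t => w t ω) (fun t => p t ω) (fun t => z t ω)) :
    Measurable[preDraw ℱ l t] (w t) := by
  rw [← funext fun ω => (hrun ω).p_mean t ht]
  exact hgame.measurable_preDraw_mean ht

theorem IsPredictionGame.integral_inner_importanceWeightedEst [IsFiniteMeasure P]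
    (hgame : IsPredictionGame P ℱ S n p V l) (ht : t < n) (hS : ∀ v ∈ S, ∀ i, 0 ≤ v i)
    (hrun : ∀ ω, IsCLEBRun (nonnegOrthant d) F S n (fun t => w t ω) (fun t => p t ω)
      (fun t => z t ω))
    {u : EuclideanSpace ℝ (Fin d)} (hu : ∀ i, 0 ≤ u i)
    (hint : Integrable (fun ω => inner ℝ (l t ω) u) P) :
    Integrable (fun ω => inner ℝ (importanceWeightedEst (l t ω) (V t ω) (w t ω)) u) P ∧
      ∫ ω, inner ℝ (importanceWeightedEst (l t ω) (V t ω) (w t ω)) u ∂P =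
        ∫ ω, inner ℝ (l t ω) u ∂P := by
  have hw : ∀ ω i, 0 < w t ω i := fun ω => (hrun ω).weight_pos ht.le
  have hmean : (fun ω => ∑ v ∈ S, p t ω v * inner ℝ (importanceWeightedEst (l t ω) v (w t ω)) u) =
      fun ω => inner ℝ (l t ω) u := funext fun ω =>
    sum_mul_inner_importanceWeightedEst ((hrun ω).p_mean t ht) (fun i => (hw ω i).ne') u
  have hest0 : ∀ ω, ∀ v ∈ S, 0 ≤ inner ℝ (importanceWeightedEst (l t ω) v (w t ω)) u :=
    fun ω v hv => inner_nonneg_of_nonneg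
      (fun i => mul_nonneg (hgame.l_nonneg t ht ω i) (div_nonneg (hS v hv i) (hw ω i).le)) hu
  have hmeas : ∀ v ∈ S, Measurable[preDraw ℱ l t]
      fun ω => inner ℝ (importanceWeightedEst (l t ω) v (w t ω)) u := fun v _ =>
    (measurable_importanceWeightedEst measurable_preDraw_loss
      (hgame.measurable_preDraw_weight ht hrun) v).inner measurable_const
  have hfreeze := hgame.integrable_apply_and_integral_eq ht (fun ω => (hrun ω).p_nonneg t ht) hmeas
    hest0 (by rwa [hmean])
  rwa [hmean] at hfreeze

theorem IsPredictionGame.integral_dualLocalNormSq_le [IsProbabilityMeasure P]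
    (hgame : IsPredictionGame P ℱ S n p V l) (ht : t < n) {q : ℝ} (hq : 1 ≤ q)
    (hS : ∀ v ∈ S, ∀ i, v i ∈ Set.Icc (0 : ℝ) 1) (hScover : ∀ i, ∃ v ∈ S, v i = 1)
    (hL2 : ∀ ω, ∀ v ∈ S, inner ℝ (l t ω) v ≤ 1)
    (hrun : ∀ ω, IsCLEBRun (nonnegOrthant d) F S n (fun t => w t ω) (fun t => p t ω)
      (fun t => z t ω)) :
    Integrable (fun ω => dualLocalNormSq q (w t ω)
        (importanceWeightedEst (l t ω) (V t ω) (w t ω))) P ∧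
      ∫ ω, dualLocalNormSq q (w t ω) (importanceWeightedEst (l t ω) (V t ω) (w t ω)) ∂P ≤
        (d : ℝ) ^ (1 - 1 / q) := by
  let f : Ω → EuclideanSpace ℝ (Fin d) → ℝ := fun ω v =>
    dualLocalNormSq q (w t ω) (importanceWeightedEst (l t ω) v (w t ω))
  have hw : ∀ ω i, 0 < w t ω i := fun ω => (hrun ω).weight_pos ht.le
  have hp0 : ∀ ω, ∀ v ∈ S, 0 ≤ p t ω v := fun ω => (hrun ω).p_nonneg t ht
  have hl : ∀ ω i, l t ω i ∈ Set.Icc (0 : ℝ) 1 := fun ω i => by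
    obtain ⟨v, hv, hvi⟩ := hScover i
    exact ⟨hgame.l_nonneg t ht ω i, apply_le_one_of_inner_le_one (hgame.l_nonneg t ht ω)
      (fun j => (hS v hv j).1) (hL2 ω v hv) hvi⟩
  have hle : ∀ ω, ∑ v ∈ S, p t ω v * f ω v ≤ (d : ℝ) ^ (1 - 1 / q) := fun ω =>
    sum_mul_dualLocalNormSq_importanceWeightedEst_le hq hS (hp0 ω) ((hrun ω).p_mean t ht) (hw ω)
      (hl ω) (inner_le_one_of_mem_convexHull (hL2 ω) ((hrun ω).mem ht.le).1)
  have hf0 : ∀ ω, ∀ v ∈ S, 0 ≤ f ω v := fun ω v _ =>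
    dualLocalNormSq_nonneg q (fun i => (hw ω i).le) _
  have hwm := hgame.measurable_preDraw_weight ht hrun
  have hf : ∀ v ∈ S, Measurable[preDraw ℱ l t] fun ω => f ω v := fun v _ =>
    measurable_dualLocalNormSq q hwm
      (measurable_importanceWeightedEst measurable_preDraw_loss hwm v)
  have hint : Integrable (fun ω => ∑ v ∈ S, p t ω v * f ω v) P := by
    refine Integrable.of_bound (Finset.measurable_fun_sum S fun v hv => ?_).aestronglyMeasurable
      ((d : ℝ) ^ (1 - 1 / q)) (ae_of_all _ fun ω => ?_)
    · exact ((hgame.p_meas t ht v hv).mono (ℱ.le t) le_rfl).mul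
        ((hf v hv).mono (hgame.preDraw_le ht) le_rfl)
    · rw [Real.norm_of_nonneg
        (Finset.sum_nonneg fun v hv => mul_nonneg (hp0 ω v hv) (hf0 ω v hv))]
      exact hle ω
  obtain ⟨hfint, hfeq⟩ := hgame.integrable_apply_and_integral_eq ht hp0 hf hf0 hint
  refine ⟨hfint, hfeq.trans_le ?_⟩
  simpa using integral_mono hint (integrable_const _) hle

end Game

/-! ### The regret of linpoly -/

theorem sum_integral_sub_sum_integral_le {Ω : Type*} {mΩ : MeasurableSpace Ω} {P : Measure Ω}
    [IsProbabilityMeasure P] {n : ℕ} {X Y N : ℕ → Ω → ℝ} {a b c : ℝ}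
    (hX : ∀ t < n, Integrable (X t) P) (hY : ∀ t < n, Integrable (Y t) P)
    (hN : ∀ t < n, Integrable (N t) P) (hb : 0 ≤ b) (hc : ∀ t < n, ∫ ω, N t ω ∂P ≤ c)
    (hle : ∀ ω, ∑ t ∈ Finset.range n, (X t ω - Y t ω) ≤ a + b * ∑ t ∈ Finset.range n, N t ω) :
    ∑ t ∈ Finset.range n, ∫ ω, X t ω ∂P - ∑ t ∈ Finset.range n, ∫ ω, Y t ω ∂P ≤
      a + b * (n * c) := by
  have hXY : ∀ t ∈ Finset.range n, Integrable (fun ω => X t ω - Y t ω) P := fun t ht =>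
    (hX t (Finset.mem_range.1 ht)).sub (hY t (Finset.mem_range.1 ht))
  have hN' : ∀ t ∈ Finset.range n, Integrable (N t) P := fun t ht => hN t (Finset.mem_range.1 ht)
  have hNsum := (integrable_finsetSum _ hN').const_mul b
  calc ∑ t ∈ Finset.range n, ∫ ω, X t ω ∂P - ∑ t ∈ Finset.range n, ∫ ω, Y t ω ∂P
      = ∫ ω, ∑ t ∈ Finset.range n, (X t ω - Y t ω) ∂P := by
        rw [integral_finsetSum _ hXY, ← Finset.sum_sub_distrib]
        exact Finset.sum_congr rfl fun t ht =>
          (integral_sub (hX t (Finset.mem_range.1 ht)) (hY t (Finset.mem_range.1 ht))).symm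
    _ ≤ ∫ ω, (a + b * ∑ t ∈ Finset.range n, N t ω) ∂P :=
        integral_mono (integrable_finsetSum _ hXY) ((integrable_const a).add hNsum) hle
    _ = a + b * ∑ t ∈ Finset.range n, ∫ ω, N t ω ∂P := by
        rw [integral_add (integrable_const a) hNsum, integral_const_mul,
          integral_finsetSum _ hN']
        simp
    _ ≤ a + b * (n * c) := by
        gcongr
        simpa using Finset.sum_le_card_nsmul _ _ c fun t ht => hc t (Finset.mem_range.1 ht)

section Regret

variable {d n : ℕ} {S : Finset (EuclideanSpace ℝ (Fin d))} {Ω : Type*} {mΩ : MeasurableSpace Ω}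
  {P : Measure Ω}

theorem expectedRegret_le (hS : S.Nonempty) {V l : ℕ → Ω → EuclideanSpace ℝ (Fin d)} {c : ℝ}
    (hV : ∀ t < n, Integrable (fun ω => inner ℝ (l t ω) (V t ω)) P)
    (hl : ∀ t < n, ∀ v ∈ S, Integrable (fun ω => inner ℝ (l t ω) v) P)
    (hle : ∀ v ∈ S, ∑ t ∈ Finset.range n, ∫ ω, inner ℝ (l t ω) (V t ω) ∂P -
      ∑ t ∈ Finset.range n, ∫ ω, inner ℝ (l t ω) v ∂P ≤ c) :
    expectedRegret P S hS n V l ≤ c := by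
  obtain ⟨v, hv, hmin⟩ := S.exists_mem_eq_inf' hS
    fun v => ∫ ω, ∑ t ∈ Finset.range n, inner ℝ (l t ω) v ∂P
  rw [expectedRegret, hmin, integral_finsetSum _ fun t ht => hV t (Finset.mem_range.1 ht),
    integral_finsetSum _ fun t ht => hl t (Finset.mem_range.1 ht) v hv]
  exact hle v hv

theorem expectedRegret_linpoly_le [IsProbabilityMeasure P] (hS : S.Nonempty)
    (hS01 : ∀ v ∈ S, ∀ i, v i ∈ Set.Icc (0 : ℝ) 1) (hScover : ∀ i, ∃ v ∈ S, v i = 1)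
    {q η : ℝ} (hq : 1 < q) (hη : 0 < η) {ℱ : Filtration ℕ mΩ}
    {w : ℕ → Ω → EuclideanSpace ℝ (Fin d)} {p : ℕ → Ω → EuclideanSpace ℝ (Fin d) → ℝ}
    {V l : ℕ → Ω → EuclideanSpace ℝ (Fin d)} (hgame : IsPredictionGame P ℱ S n p V l)
    (hL2 : ∀ t < n, ∀ ω, ∀ v ∈ S, inner ℝ (l t ω) v ≤ 1)
    (hrun : ∀ ω, IsLinpolyRun q η S n (fun t => w t ω) (fun t => p t ω)
      (fun t => V t ω) (fun t => l t ω)) :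
    expectedRegret P S hS n V l ≤
      d / ((q - 1) * η) + η * q / 2 * (n * (d : ℝ) ^ (1 - 1 / q)) := by
  have hcleb := fun ω => (hrun ω).cleb
  have hS0 : ∀ v ∈ S, ∀ i, 0 ≤ v i := fun v hv i => (hS01 v hv i).1
  have hplayed : ∀ t < n, Integrable (fun ω => inner ℝ (l t ω) (V t ω)) P := fun t ht =>
    hgame.integrable_inner_loss ht hS0 (hL2 t ht) (hgame.measurable_action ht) (hgame.V_mem t ht)
  have hfixed : ∀ t < n, ∀ v ∈ S, Integrable (fun ω => inner ℝ (l t ω) v) P := fun t ht v hv =>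
    hgame.integrable_inner_loss ht hS0 (hL2 t ht) measurable_const fun _ => hv
  refine expectedRegret_le hS hplayed hfixed fun v hv => ?_
  have hest := fun t (ht : t < n) => hgame.integral_inner_importanceWeightedEst ht hS0 hcleb
    (hS0 v hv) (hfixed t ht v hv)
  have hnorm := fun t (ht : t < n) =>
    hgame.integral_dualLocalNormSq_le ht hq.le hS01 hScover (hL2 t ht) hcleb
  rw [← Finset.sum_congr rfl fun t ht => (hest t (Finset.mem_range.1 ht)).2]
  refine sum_integral_sub_sum_integral_le hplayed (fun t ht => (hest t ht).1)
    (fun t ht => (hnorm t ht).1) (by positivity) (fun t ht => (hnorm t ht).2) fun ω => ?_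
  exact (hrun ω).sum_inner_sub_inner_le hq hη (fun t ht => hgame.l_nonneg t ht ω)
    (fun t ht => hS0 _ (hgame.V_mem t ht ω)) hv (hS01 v hv)

end Regret

/-! ### Tuning of the parameters -/

theorem linpoly_tuned_bound {q η D N : ℝ} (hq : 1 < q) (hD : 0 < D) (hN : 0 < N)
    (hη : η = √(2 * D ^ (1 / q) / (q * (q - 1) * N))) :
    D / ((q - 1) * η) + η * q / 2 * (N * D ^ (1 - 1 / q)) =
      √(2 * q * N * D / (q - 1) * D ^ (1 - 1 / q)) := by
  have hq1 : 0 < q - 1 := by linarith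
  have hη0 : 0 < η := by rw [hη]; positivity
  have hη2 : η ^ 2 * (q * (q - 1) * N) = 2 * D ^ (1 / q) := by
    rw [hη, Real.sq_sqrt (by positivity)]
    field_simp
  have hpow : D ^ (1 - 1 / q) = D / D ^ (1 / q) := by rw [Real.rpow_sub hD, Real.rpow_one]
  have hA0 : 0 < D ^ (1 / q) := by positivity
  rw [hpow]
  set A := D ^ (1 / q)
  have hbalanced : η * q / 2 * (N * (D / A)) = D / ((q - 1) * η) := by
    field_simp
    linarith
  have hsq : (2 * (D / ((q - 1) * η))) ^ 2 = 2 * q * N * D / (q - 1) * (D / A) := by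
    field_simp
    linarith
  rw [hbalanced, ← two_mul, ← hsq, Real.sqrt_sq (by positivity)]

theorem div_sub_one_eq_log_exp_one_mul {D q : ℝ} (hD : 1 < D) (hq : q = 1 + (Real.log D)⁻¹) :
    q / (q - 1) = Real.log (Real.exp 1 * D) := by
  have hlog : 0 < Real.log D := Real.log_pos hD
  rw [Real.log_mul (Real.exp_pos 1).ne' (by linarith), Real.log_exp, hq]
  field_simp
  ring

theorem rpow_one_sub_one_div_le_exp_one {D q : ℝ} (hD : 1 < D) (hq : q = 1 + (Real.log D)⁻¹) :
    D ^ (1 - 1 / q) ≤ Real.exp 1 := by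
  have hlog : 0 < Real.log D := Real.log_pos hD
  have hexponent : Real.log D * (1 - 1 / q) = Real.log D / (Real.log D + 1) := by
    rw [hq]
    field_simp
    ring
  rw [Real.rpow_def_of_pos (by linarith), Real.exp_le_exp, hexponent, div_le_one (by positivity)]
  linarith

theorem mainTheorem4_general {d : ℕ} (hd : 0 < d) {n : ℕ} (hn : 0 < n)
    (S : Finset (EuclideanSpace ℝ (Fin d))) (hS : S.Nonempty)
    (hS01 : ∀ v ∈ S, ∀ i, v i ∈ Set.Icc (0 : ℝ) 1)
    (hScover : ∀ i, ∃ v ∈ S, v i = 1)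
    (q η : ℝ) (hq : 1 < q)
    (hη : η = √(2 * (d : ℝ) ^ (1 / q) / (q * (q - 1) * n)))
    {Ω : Type*} {mΩ : MeasurableSpace Ω} (P : Measure Ω) [IsProbabilityMeasure P]
    (ℱ : Filtration ℕ mΩ)
    (w : ℕ → Ω → EuclideanSpace ℝ (Fin d))
    (p : ℕ → Ω → EuclideanSpace ℝ (Fin d) → ℝ)
    (V l : ℕ → Ω → EuclideanSpace ℝ (Fin d))
    (hgame : IsPredictionGame P ℱ S n p V l)
    (hL2 : ∀ t < n, ∀ ω, ∀ v ∈ S, inner ℝ (l t ω) v ≤ 1)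
    (hrun : ∀ ω, IsLinpolyRun q η S n (fun t => w t ω) (fun t => p t ω)
      (fun t => V t ω) (fun t => l t ω)) :
    expectedRegret P S hS n V l ≤
        √(2 * q * n * d / (q - 1) * (d : ℝ) ^ (1 - 1 / q)) ∧
      (2 ≤ d → q = 1 + (Real.log d)⁻¹ →
        expectedRegret P S hS n V l ≤
          √(2 * n * d * Real.exp 1 * Real.log (Real.exp 1 * d))) := by
  have hη0 : 0 < η := by rw [hη]; positivity
  have hbound : expectedRegret P S hS n V l ≤ √(2 * q * n * d / (q - 1) * (d : ℝ) ^ (1 - 1 / q)) :=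
    (expectedRegret_linpoly_le hS hS01 hScover hq hη0 hgame hL2 hrun).trans_eq
      (linpoly_tuned_bound hq (by positivity) (by positivity) hη)
  refine ⟨hbound, fun hd2 hqd => hbound.trans (Real.sqrt_le_sqrt ?_)⟩
  have hd1 : (1 : ℝ) < d := by exact_mod_cast hd2
  calc 2 * q * n * d / (q - 1) * (d : ℝ) ^ (1 - 1 / q)
      = 2 * n * d * (d : ℝ) ^ (1 - 1 / q) * (q / (q - 1)) := by ring
    _ ≤ 2 * n * d * Real.exp 1 * (q / (q - 1)) := by
        gcongr
        exact rpow_one_sub_one_div_le_exp_one hd1 hqd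
    _ = 2 * n * d * Real.exp 1 * Real.log (Real.exp 1 * d) := by
        rw [div_sub_one_eq_log_exp_one_mul hd1 hqd]

theorem mainTheorem4 {d : ℕ} (hd : 0 < d) {n : ℕ} (hn : 0 < n)
    (S : Finset (EuclideanSpace ℝ (Fin d))) (hS : S.Nonempty)
    (hS01 : ∀ v ∈ S, ∀ i, v i = 0 ∨ v i = 1)
    (hScover : ∀ i, ∃ v ∈ S, v i = 1)
    (q η : ℝ) (hq : 1 < q)
    (hη : η = √(2 * (d : ℝ) ^ (1 / q) / (q * (q - 1) * n)))
    {Ω : Type*} {mΩ : MeasurableSpace Ω} (P : Measure Ω) [IsProbabilityMeasure P]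
    (ℱ : Filtration ℕ mΩ)
    (w : ℕ → Ω → EuclideanSpace ℝ (Fin d))
    (p : ℕ → Ω → EuclideanSpace ℝ (Fin d) → ℝ)
    (V l : ℕ → Ω → EuclideanSpace ℝ (Fin d))
    (hgame : IsPredictionGame P ℱ S n p V l)
    (hL2 : ∀ t < n, ∀ ω, ∀ v ∈ S, inner ℝ (l t ω) v ≤ 1)
    (hrun : ∀ ω, IsLinpolyRun q η S n (fun t => w t ω) (fun t => p t ω)
      (fun t => V t ω) (fun t => l t ω)) :
    expectedRegret P S hS n V l ≤
        √(2 * q * n * d / (q - 1) * (d : ℝ) ^ (1 - 1 / q)) ∧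
      (2 ≤ d → q = 1 + (Real.log d)⁻¹ →
        expectedRegret P S hS n V l ≤
          √(2 * n * d * Real.exp 1 * Real.log (Real.exp 1 * d))) :=
  mainTheorem4_general hd hn S hS (fun v hv i => by rcases hS01 v hv i with h | h <;> simp [h])
    hScover q η hq hη P ℱ w p V l hgame hL2 hrun
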